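/- Let $n$ be a natural number, let $u=(u_1,u_2)$ and $v=(v_1,\dots,v_n)$ be vectors of positive real numbers with $u_1+u_2=\sum_{j=1}^n v_j$, and let $$P=\Bigl\{y\in\mathbb{R}^{2\times n} : \sum_{j=1}^n y_{ij}=u_i\ (i=1,2),\quad y_{1j}+y_{2j}=v_j\ (1\le j\le n),\quad y_{ij}\ge 0\Bigr\}$$ be the $2\times n$ transportation polytope with margins $u,v$. Its graph has the vertices of $P$ as nodes, two distinct vertices being adjacent when the segment joining them is an edge (a one-dimensional face) of $P$. Let $k$ be the number of critical edges of $P$, that is, of pairs $(i,j)$ with $y_{ij}>0$ for all $y\in P$. Then: 1. The graph of $P$ has diameter at most $n$, and it also satisfies the Hirsch bound $n+1-k$; that is, its diameter is at most $\min\{n,\,n+1-k\}$. 2. (Monotone Hirsch conjecture) For every cost vector $s\in\mathbb{R}^{2\times n}$ and every vertex $y^O$ of $P$ there are a vertex $y^F$ of $P$ that maximizes $s^Ty=\sum_{i,j}s_{ij}y_{ij}$ over $P$ and a walk in the graph of $P$ from $y^O$ to $y^F$, of length at most $\min\{n,\,n+1-k\}$, along which the value of $s^Ty$ never decreases. 3.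 The bound $n$ on the diameter is tight for all $n\ge 3$: for every $n\ge 3$ there are such margins $u,v$ for which the graph of $P$ has diameter exactly $n$. -/

import Mathlib

/-- The set of feasible flow assignments of the `m × n` transportation problem with
supplies `u` and demands `v`. -/
def transportationPolytope {m n : ℕ} (u : Fin m → ℝ) (v : Fin n → ℝ) :
    Set (Matrix (Fin m) (Fin n) ℝ) :=
  {y | (∀ i, ∑ j, y i j = u i) ∧ (∀ j, ∑ i, y i j = v j) ∧ ∀ i j, 0 ≤ y i j}

/-- The graph (1-skeleton) of a polytope `P`: its nodes are the vertices (0-faces) of `P`, and two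
distinct vertices are adjacent when the segment between them is a face (an edge) of `P`. -/
def vertexEdgeGraph {E : Type*} [AddCommGroup E] [Module ℝ E] (P : Set E) :
    SimpleGraph (P.extremePoints ℝ) where
  Adj x y := x ≠ y ∧ IsExtreme ℝ P (segment ℝ (x : E) (y : E))
  symm := ⟨fun x y h => ⟨h.1.symm, by rw [segment_symm]; exact h.2⟩⟩
  loopless := ⟨fun _ h => h.1 rfl⟩

/-- The objective value `sᵀ y` of the flow assignment `y` for the cost vector `s`. -/
def objective {m n : ℕ} (s y : Matrix (Fin m) (Fin n) ℝ) : ℝ :=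
  ∑ i, ∑ j, s i j * y i j

/-- The critical edges: the pairs `(i, j)` that carry positive flow in every feasible flow
assignment. -/
def criticalEdges {m n : ℕ} (u : Fin m → ℝ) (v : Fin n → ℝ) : Set (Fin m × Fin n) :=
  {e | ∀ y ∈ transportationPolytope u v, 0 < y e.1 e.2}

/-- An edge walk is monotone for the cost vector `s` when no step decreases the objective. -/
def IsMonotoneWalk {m n : ℕ} {u : Fin m → ℝ} {v : Fin n → ℝ} (s : Matrix (Fin m) (Fin n) ℝ)
    {O F : (transportationPolytope u v).extremePoints ℝ}
    (p : (vertexEdgeGraph (transportationPolytope u v)).Walk O F) : Prop :=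
  ∀ d ∈ p.darts, objective s d.fst.1 ≤ objective s d.snd.1

/-!
A `2 × n` transportation polytope is a slice of a box: a flow `y` is determined by its first row
`x j = y 0 j`, which ranges over `0 ≤ x j ≤ v j`, `∑ j, x j = u 0`. A vertex has at most one
fractional column (`atBound_of_extreme`, `mem_extremePoints_of_atBound`), and two vertices are
adjacent exactly when they differ in two columns while all the others are at a bound
(`adj_of_eq_off`, `exists_eq_off_of_adj`). So a step in the graph moves as much flow as possible
from one column to another (`exists_adj_move`).

*Upper bounds.* Fix a target vertex `F` and a pivot column `g` off which `F` is at its bounds.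
Flow is moved from surplus to deficient columns, with the pivot as source or sink when one kind is
missing or the pivot itself is fractional. Every such step brings a column to its target value,
except that a fractional pivot may be emptied; this can happen only once, since from then on the
pivot stays at a bound until only surplus or only deficient columns are left, and it cannot happen
if both entries of the pivot column are critical (`exists_adj_potential_lt`). Hence the number of
wrong columns besides the pivot, plus one for a possible detour, bounds the length of the walk. A
count column by column shows that this number is at most `n`, and at most `n + 1 - k`
(`potential_add_ncard_criticalEdges_le`), where `k` is the number of critical edges.

*Monotonicity.* Flow off the pivot only ever moves towards the target. If `F` is a greedy optimum,
whose full columns have a cost difference `s 0 j - s 1 j` at least that of the pivot, and whose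
empty columns have one at most that of the pivot, then no such step decreases the objective
(`objective_le_of_towards`).

*Tightness.* In a nondegenerate polytope an edge corrects at most one column besides the pivot. If
the pivot is fractional at `O`, smaller than all other columns, and `F` is opposite to `O` in the
`n - 1` other columns, then the first step corrects none, so `n` steps are needed
(`le_length_of_opposite`).
-/

/-! ### The first row determines a flow -/

section Polytope

variable {n : ℕ} {u : Fin 2 → ℝ} {v : Fin n → ℝ}

/-- The flow of `y` in column `j` sits at one of its two bounds: one of the two entries of the
column vanishes. Columns that are not at a bound are called fractional. -/
def AtBound (v : Fin n → ℝ) (y : Matrix (Fin 2) (Fin n) ℝ) (j : Fin n) : Prop :=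
  y 0 j = 0 ∨ y 0 j = v j

lemma snd_row_eq {y : Matrix (Fin 2) (Fin n) ℝ} (hy : y ∈ transportationPolytope u v)
    (j : Fin n) : y 1 j = v j - y 0 j := by
  have := hy.2.1 j
  rw [Fin.sum_univ_two] at this
  linarith

lemma fst_row_nonneg {y : Matrix (Fin 2) (Fin n) ℝ} (hy : y ∈ transportationPolytope u v)
    (j : Fin n) : 0 ≤ y 0 j := hy.2.2 0 j

lemma fst_row_le {y : Matrix (Fin 2) (Fin n) ℝ} (hy : y ∈ transportationPolytope u v)
    (j : Fin n) : y 0 j ≤ v j := by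
  have := hy.2.2 1 j
  rw [snd_row_eq hy] at this
  linarith

lemma not_atBound_iff {y : Matrix (Fin 2) (Fin n) ℝ} (hy : y ∈ transportationPolytope u v)
    {j : Fin n} : ¬ AtBound v y j ↔ 0 < y 0 j ∧ y 0 j < v j := by
  unfold AtBound
  rw [not_or, (fst_row_nonneg hy j).lt_iff_ne, (fst_row_le hy j).lt_iff_ne, ne_comm]

lemma eq_of_fst_row_eq {y z : Matrix (Fin 2) (Fin n) ℝ} (hy : y ∈ transportationPolytope u v)
    (hz : z ∈ transportationPolytope u v) (h : ∀ j, y 0 j = z 0 j) : y = z := by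
  ext i j
  fin_cases i
  · exact h j
  · simp only [Fin.mk_one]
    rw [snd_row_eq hy, snd_row_eq hz, h]

/-- Since the first row sum is prescribed, all but one of the entries of the first row determine
a flow. -/
lemma eq_of_fst_row_eq_off {y z : Matrix (Fin 2) (Fin n) ℝ}
    (hy : y ∈ transportationPolytope u v) (hz : z ∈ transportationPolytope u v) (g : Fin n)
    (h : ∀ j, j ≠ g → y 0 j = z 0 j) : y = z := by
  refine eq_of_fst_row_eq hy hz fun j => ?_
  by_cases hj : j = g
  · subst hj
    have h1 := hy.1 0
    rw [← hz.1 0, ← Finset.add_sum_erase _ _ (Finset.mem_univ j),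
      ← Finset.add_sum_erase _ (z 0) (Finset.mem_univ j),
      Finset.sum_congr rfl fun k hk => h k (Finset.ne_of_mem_erase hk)] at h1
    linarith
  · exact h j hj

lemma mem_of_fst_row (hsum : ∑ i, u i = ∑ j, v j) (x : Fin n → ℝ) (hx : ∑ j, x j = u 0)
    (h0 : ∀ j, 0 ≤ x j) (hv : ∀ j, x j ≤ v j) :
    Matrix.of ![x, v - x] ∈ transportationPolytope u v := by
  refine ⟨fun i => ?_, fun j => ?_, fun i j => ?_⟩
  · fin_cases i
    · simpa using hx
    · rw [Fin.sum_univ_two] at hsum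
      simp only [Fin.mk_one, Matrix.of_apply, Matrix.cons_val_one, Pi.sub_apply,
        Finset.sum_sub_distrib, Matrix.cons_val_fin_one]
      linarith
  · simp [Fin.sum_univ_two]
  · fin_cases i
    · simpa using h0 j
    · simpa using hv j

lemma convex_transportationPolytope : Convex ℝ (transportationPolytope u v) := by
  rintro y ⟨hy1, hy2, hy3⟩ z ⟨hz1, hz2, hz3⟩ a b ha hb hab
  refine ⟨fun i => ?_, fun j => ?_, fun i j => ?_⟩
  · simp only [Matrix.add_apply, Matrix.smul_apply, smul_eq_mul, Finset.sum_add_distrib,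
      ← Finset.mul_sum, hy1, hz1]
    rw [← add_mul, hab, one_mul]
  · simp only [Matrix.add_apply, Matrix.smul_apply, smul_eq_mul, Finset.sum_add_distrib,
      ← Finset.mul_sum, hy2, hz2]
    rw [← add_mul, hab, one_mul]
  · have := mul_nonneg ha (hy3 i j)
    have := mul_nonneg hb (hz3 i j)
    simp only [Matrix.add_apply, Matrix.smul_apply, smul_eq_mul]
    linarith

/-! ### Exchanging flow between two columns -/

/-- The direction that moves one unit of first-row flow from column `b` to column `a`, and
compensates in the second row. -/
def exchange (a b : Fin n) : Matrix (Fin 2) (Fin n) ℝ :=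
  Matrix.of ![Pi.single a 1 - Pi.single b 1, Pi.single b 1 - Pi.single a 1]

lemma exchange_zero_left {a b : Fin n} (hab : a ≠ b) : exchange a b 0 a = 1 := by
  simp [exchange, hab]

lemma exchange_zero_right {a b : Fin n} (hab : a ≠ b) : exchange a b 0 b = -1 := by
  simp [exchange, hab.symm]

lemma exchange_zero_of_ne {a b j : Fin n} (ha : j ≠ a) (hb : j ≠ b) :
    exchange a b 0 j = 0 := by
  simp [exchange, ha, hb]

lemma exchange_one (a b j : Fin n) : exchange a b 1 j = - exchange a b 0 j := by
  simp [exchange]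

lemma sum_exchange (a b : Fin n) : ∑ j, exchange a b 0 j = 0 := by
  simp [exchange]

lemma add_exchange_mem {y : Matrix (Fin 2) (Fin n) ℝ} (hy : y ∈ transportationPolytope u v)
    {a b : Fin n} (hab : a ≠ b) {ε : ℝ} (ha0 : 0 ≤ y 0 a + ε) (hav : y 0 a + ε ≤ v a)
    (hb0 : 0 ≤ y 0 b - ε) (hbv : y 0 b - ε ≤ v b) :
    y + ε • exchange a b ∈ transportationPolytope u v := by
  have key : ∀ j, 0 ≤ y 0 j + ε * exchange a b 0 j ∧ y 0 j + ε * exchange a b 0 j ≤ v j := by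
    intro j
    by_cases hja : j = a
    · subst hja
      rw [exchange_zero_left hab]
      constructor <;> linarith
    by_cases hjb : j = b
    · subst hjb
      rw [exchange_zero_right hab]
      constructor <;> linarith
    rw [exchange_zero_of_ne hja hjb]
    constructor
    · linarith [fst_row_nonneg hy j]
    · linarith [fst_row_le hy j]
  refine ⟨fun i => ?_, fun j => ?_, fun i j => ?_⟩
  · simp only [Matrix.add_apply, Matrix.smul_apply, smul_eq_mul, Finset.sum_add_distrib,
      ← Finset.mul_sum, hy.1]
    fin_cases i
    · simp [sum_exchange]
    · simp [exchange_one, sum_exchange]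
  · have := hy.2.1 j
    rw [Fin.sum_univ_two] at this ⊢
    simp only [Matrix.add_apply, Matrix.smul_apply, smul_eq_mul, exchange_one]
    linarith
  · fin_cases i
    · exact (key j).1
    · have := (key j).2
      simp only [Fin.mk_one, Matrix.add_apply, Matrix.smul_apply, smul_eq_mul, exchange_one,
        snd_row_eq hy]
      linarith

/-- Around a flow with two fractional columns there is room to move in both directions. -/
lemma exists_pos_add_sub_exchange_mem {y : Matrix (Fin 2) (Fin n) ℝ}
    (hy : y ∈ transportationPolytope u v) {a b : Fin n} (hab : a ≠ b)
    (ha : ¬ AtBound v y a) (hb : ¬ AtBound v y b) :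
    ∃ ε : ℝ, 0 < ε ∧ y + ε • exchange a b ∈ transportationPolytope u v ∧
      y - ε • exchange a b ∈ transportationPolytope u v := by
  rw [not_atBound_iff hy] at ha hb
  obtain ⟨ε, hε, h⟩ : ∃ ε : ℝ, 0 < ε ∧
      ε ≤ y 0 a ∧ ε ≤ v a - y 0 a ∧ ε ≤ y 0 b ∧ ε ≤ v b - y 0 b := by
    refine ⟨min (min (y 0 a) (v a - y 0 a)) (min (y 0 b) (v b - y 0 b)), ?_, ?_, ?_, ?_, ?_⟩
    · refine lt_min (lt_min ha.1 ?_) (lt_min hb.1 ?_) <;> linarith [ha.2, hb.2]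
    all_goals simp
  obtain ⟨h1, h2, h3, h4⟩ := h
  refine ⟨ε, hε, add_exchange_mem hy hab ?_ ?_ ?_ ?_, ?_⟩
  any_goals linarith
  rw [sub_eq_add_neg, ← neg_smul]
  apply add_exchange_mem hy hab <;> linarith

/-! ### Vertices and edges -/

/-- A coordinate at a bound stays fixed on every segment of the polytope through the point. -/
lemma fst_row_eq_of_mem_openSegment {y a b : Matrix (Fin 2) (Fin n) ℝ}
    (ha : a ∈ transportationPolytope u v) (hb : b ∈ transportationPolytope u v)
    (hy : y ∈ openSegment ℝ a b) {j : Fin n} (hj : AtBound v y j) : a 0 j = y 0 j := by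
  obtain ⟨s, t, hs, ht, hst, rfl⟩ := hy
  have ha0 := fst_row_nonneg ha j
  have hb0 := fst_row_nonneg hb j
  have hav := fst_row_le ha j
  have hbv := fst_row_le hb j
  obtain rfl : t = 1 - s := by linarith
  simp only [AtBound, Matrix.add_apply, Matrix.smul_apply, smul_eq_mul] at hj ⊢
  rcases hj with h | h
  · have h1 : s * a 0 j = 0 := by nlinarith
    have h2 : a 0 j = 0 := by simpa [hs.ne'] using h1
    rw [h, h2]
  · have h1 : s * (v j - a 0 j) = 0 := by nlinarith
    have h2 : v j - a 0 j = 0 := by simpa [hs.ne'] using h1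
    linarith

/-- A vertex has at most one fractional column. -/
lemma atBound_of_extreme {y : Matrix (Fin 2) (Fin n) ℝ}
    (hy : y ∈ (transportationPolytope u v).extremePoints ℝ) {f j : Fin n}
    (hf : ¬ AtBound v y f) (hj : j ≠ f) : AtBound v y j := by
  by_contra hj'
  obtain ⟨ε, hε, h1, h2⟩ := exists_pos_add_sub_exchange_mem hy.1 hj hj' hf
  have h := hy.2 h1 h2 (mem_openSegment_add_sub _ _)
  have h3 := congrFun (congrFun h 0) j
  simp only [Matrix.add_apply, Matrix.smul_apply, smul_eq_mul, exchange_zero_left hj] at h3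
  linarith

lemma mem_extremePoints_of_atBound {y : Matrix (Fin 2) (Fin n) ℝ}
    (hy : y ∈ transportationPolytope u v) (g : Fin n) (h : ∀ j, j ≠ g → AtBound v y j) :
    y ∈ (transportationPolytope u v).extremePoints ℝ :=
  ⟨hy, fun _ ha _ hb hab => eq_of_fst_row_eq_off ha hy g fun j hj =>
    fst_row_eq_of_mem_openSegment ha hb hab (h j hj)⟩

/-- Every vertex is at a bound outside some column. -/
lemma exists_forall_ne_atBound [NeZero n] {y : Matrix (Fin 2) (Fin n) ℝ}
    (hy : y ∈ (transportationPolytope u v).extremePoints ℝ) :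
    ∃ g, ∀ j, j ≠ g → AtBound v y j := by
  by_cases h : ∃ g, ¬ AtBound v y g
  · obtain ⟨g, hg⟩ := h
    exact ⟨g, fun j hj => atBound_of_extreme hy hg hj⟩
  · push Not at h
    exact ⟨0, fun j _ => h j⟩

lemma fst_row_add_eq {y z : Matrix (Fin 2) (Fin n) ℝ}
    (hy : y ∈ transportationPolytope u v) (hz : z ∈ transportationPolytope u v) {a b : Fin n}
    (hab : a ≠ b) (h : ∀ j, j ≠ a → j ≠ b → y 0 j = z 0 j) :
    y 0 a + y 0 b = z 0 a + z 0 b := by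
  have h1 := hy.1 0
  have hb : b ∈ Finset.univ.erase a := by simp [hab.symm]
  rw [← hz.1 0, ← Finset.add_sum_erase _ _ (Finset.mem_univ a),
    ← Finset.add_sum_erase _ (z 0) (Finset.mem_univ a),
    ← Finset.add_sum_erase _ _ hb, ← Finset.add_sum_erase _ (z 0) hb,
    Finset.sum_congr rfl fun k hk => h k
      (Finset.ne_of_mem_erase (Finset.mem_of_mem_erase hk)) (Finset.ne_of_mem_erase hk)] at h1
  linarith

/-- Two vertices that differ in two columns only, with all the other columns at a bound, are
adjacent. -/
lemma adj_of_eq_off {y z : (transportationPolytope u v).extremePoints ℝ} (hyz : y ≠ z)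
    {a b : Fin n} (hab : a ≠ b)
    (h : ∀ j, j ≠ a → j ≠ b → y.1 0 j = z.1 0 j ∧ AtBound v y.1 j) :
    (vertexEdgeGraph (transportationPolytope u v)).Adj y z := by
  obtain ⟨y, hy⟩ := y
  obtain ⟨z, hz⟩ := z
  have hne : y ≠ z := fun e => hyz (Subtype.ext e)
  refine ⟨hyz, convex_transportationPolytope.segment_subset hy.1 hz.1, ?_⟩
  intro p hp q hq r hr hrpq
  simp only at h hr ⊢
  have hpj : ∀ j, j ≠ a → j ≠ b → p 0 j = y 0 j := by
    intro j hja hjb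
    have hrj : r 0 j = y 0 j := by
      obtain ⟨s, t, hs, ht, hst, rfl⟩ := hr
      simp only [Matrix.add_apply, Matrix.smul_apply, smul_eq_mul, ← (h j hja hjb).1]
      rw [← add_mul, hst, one_mul]
    rw [← hrj]
    refine fst_row_eq_of_mem_openSegment hp hq hrpq ?_
    unfold AtBound
    rw [hrj]
    exact (h j hja hjb).2
  have hsz := fst_row_add_eq hy.1 hz.1 hab fun j hja hjb => (h j hja hjb).1
  have hsp := fst_row_add_eq hp hy.1 hab hpj
  have hΔ : z 0 a - y 0 a ≠ 0 := by
    intro h0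
    refine hne (eq_of_fst_row_eq_off hy.1 hz.1 b fun j hjb => ?_)
    by_cases hja : j = a
    · subst hja; linarith
    · exact (h j hja hjb).1
  -- `p` lies on the line through `y` and `z`, and the extremality of `y` and `z` confines it to
  -- the segment.
  obtain ⟨θ, hθ⟩ : ∃ θ : ℝ, p = (1 - θ) • y + θ • z := by
    refine ⟨(p 0 a - y 0 a) / (z 0 a - y 0 a), ?_⟩
    set θ := (p 0 a - y 0 a) / (z 0 a - y 0 a) with hθ
    have hθ' : θ * (z 0 a - y 0 a) = p 0 a - y 0 a := by rw [hθ]; field_simp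
    have h0 : ∀ j, p 0 j = (1 - θ) * y 0 j + θ * z 0 j := by
      intro j
      by_cases hja : j = a
      · subst hja; linarith
      by_cases hjb : j = b
      · subst hjb
        have : z 0 j - y 0 j = -(z 0 a - y 0 a) := by linarith
        have h5 : θ * (z 0 j - y 0 j) = -(p 0 a - y 0 a) := by rw [this]; linarith
        linarith
      · rw [hpj j hja hjb, ← (h j hja hjb).1]; ring
    ext i j
    fin_cases i
    · simpa using h0 j
    · simp only [Fin.mk_one, Matrix.add_apply, Matrix.smul_apply, smul_eq_mul, snd_row_eq hp,
        snd_row_eq hy.1, snd_row_eq hz.1, h0 j]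
      ring
  rcases lt_or_ge θ 0 with hneg | hpos
  · exfalso
    have h1 : y ∈ openSegment ℝ z p := by
      refine ⟨-θ / (1 - θ), 1 / (1 - θ), by apply div_pos <;> linarith,
        by apply div_pos <;> linarith, by rw [← add_div, div_eq_one_iff_eq] <;> linarith, ?_⟩
      have : 1 - θ ≠ 0 := by linarith
      rw [hθ, smul_add, smul_smul, smul_smul, one_div_mul_cancel this]
      rw [add_comm, add_assoc, ← add_smul]
      have : 1 / (1 - θ) * θ + -θ / (1 - θ) = 0 := by ring
      rw [this]; simp
    exact hne (hy.2 hz.1 hp h1).symm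
  rcases lt_or_ge 1 θ with hgt | hle
  · exfalso
    have h1 : z ∈ openSegment ℝ y p := by
      refine ⟨(θ - 1) / θ, 1 / θ, by apply div_pos <;> linarith,
        by apply div_pos <;> linarith, by rw [← add_div, div_eq_one_iff_eq] <;> linarith, ?_⟩
      have : θ ≠ 0 := by linarith
      rw [hθ, smul_add, smul_smul, smul_smul, one_div_mul_cancel this]
      rw [← add_assoc, ← add_smul]
      have : (θ - 1) / θ + 1 / θ * (1 - θ) = 0 := by ring
      rw [this]; simp
    exact hne (hz.2 hy.1 hp h1)
  · exact ⟨1 - θ, θ, by linarith, hpos, by ring, hθ.symm⟩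

/-- Adjacent vertices differ in two columns only, and all the other columns are at a bound: the
midpoint of an edge cannot be moved within the polytope in a direction other than the edge's. -/
lemma exists_eq_off_of_adj {y z : (transportationPolytope u v).extremePoints ℝ}
    (h : (vertexEdgeGraph (transportationPolytope u v)).Adj y z) :
    ∃ a b, a ≠ b ∧ ∀ j, j ≠ a → j ≠ b → y.1 0 j = z.1 0 j ∧ AtBound v y.1 j := by
  obtain ⟨y, hy⟩ := y
  obtain ⟨z, hz⟩ := z
  obtain ⟨hne, hsub, hext⟩ := h
  replace hne : y ≠ z := fun e => hne (Subtype.ext e)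
  simp only at hsub hext ⊢
  set m : Matrix (Fin 2) (Fin n) ℝ := midpoint ℝ y z with hm
  have hmseg : m ∈ segment ℝ y z := midpoint_mem_segment y z
  have hmP := hsub hmseg
  have hmj : ∀ j, m 0 j = (y 0 j + z 0 j) / 2 := by
    intro j
    rw [hm, midpoint_eq_smul_add]
    simp [Matrix.smul_apply]
    ring
  have hy0 := fst_row_nonneg hy.1
  have hz0 := fst_row_nonneg hz.1
  have hyv := fst_row_le hy.1
  have hzv := fst_row_le hz.1
  have hfrac : ∀ j, y 0 j ≠ z 0 j → ¬ AtBound v m j := by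
    intro j hj
    rw [not_atBound_iff hmP, hmj]
    rcases lt_or_gt_of_ne hj with h | h
    · constructor <;> linarith [hy0 j, hz0 j, hyv j, hzv j]
    · constructor <;> linarith [hy0 j, hz0 j, hyv j, hzv j]
  -- Moving `m` along an exchange of two fractional columns stays on the edge.
  have hpar : ∀ a b, a ≠ b → ¬ AtBound v m a → ¬ AtBound v m b →
      ∀ j, j ≠ a → j ≠ b → y 0 j = z 0 j := by
    intro a b hab ha hb j hja hjb
    obtain ⟨ε, hε, h1, h2⟩ := exists_pos_add_sub_exchange_mem hmP hab ha hb
    obtain ⟨s, t, hs, ht, hst, h3⟩ := hext h1 h2 hmseg (mem_openSegment_add_sub _ _)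
    have ea := congrFun (congrFun h3 0) a
    have ej := congrFun (congrFun h3 0) j
    simp only [Matrix.add_apply, Matrix.smul_apply, smul_eq_mul, exchange_zero_left hab,
      exchange_zero_of_ne hja hjb, hmj] at ea ej
    obtain rfl : s = 1 - t := by linarith
    have e1 : (t - 1 / 2) * (z 0 j - y 0 j) = 0 := by linarith
    rcases mul_eq_zero.1 e1 with e2 | e2
    · have e3 : (t - 1 / 2) * (z 0 a - y 0 a) = ε := by linarith
      rw [e2] at e3
      linarith
    · linarith
  obtain ⟨a, ha⟩ : ∃ a, y 0 a ≠ z 0 a := by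
    by_contra! hcon
    exact hne (eq_of_fst_row_eq hy.1 hz.1 hcon)
  obtain ⟨b, hba, hb⟩ : ∃ b, b ≠ a ∧ y 0 b ≠ z 0 b := by
    by_contra! hcon
    exact hne (eq_of_fst_row_eq_off hy.1 hz.1 a hcon)
  refine ⟨a, b, hba.symm, fun j hja hjb => ?_⟩
  have hj := hpar a b hba.symm (hfrac a ha) (hfrac b hb) j hja hjb
  refine ⟨hj, ?_⟩
  by_contra hjb'
  have hmjb : ¬ AtBound v m j := by
    unfold AtBound at hjb' ⊢
    rwa [hmj, ← hj, add_self_div_two]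
  exact hb (hpar a j hja.symm (hfrac a ha) hmjb b hba hjb.symm)

end Polytope

section Walk

/-! ### Steps between vertices -/

variable {n : ℕ} {u : Fin 2 → ℝ} {v : Fin n → ℝ}

/-- Moving as much flow as possible from column `b` to column `a` leads from a vertex to an
adjacent vertex, provided all the other columns are at a bound. -/
lemma exists_adj_move (O : (transportationPolytope u v).extremePoints ℝ) {a b : Fin n}
    (hab : a ≠ b) (ha : O.1 0 a < v a) (hb : 0 < O.1 0 b)
    (h : ∀ j, j ≠ a → j ≠ b → AtBound v O.1 j) :
    ∃ O' : (transportationPolytope u v).extremePoints ℝ,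
      (vertexEdgeGraph (transportationPolytope u v)).Adj O O' ∧
      (∀ j, j ≠ a → j ≠ b → O'.1 0 j = O.1 0 j) ∧
      O.1 0 a < O'.1 0 a ∧ O'.1 0 a + O'.1 0 b = O.1 0 a + O.1 0 b ∧
      (O'.1 0 a = v a ∨ O'.1 0 b = 0) := by
  obtain ⟨O, hO⟩ := O
  simp only at ha hb h ⊢
  obtain ⟨δ, hδ, hδa, hδb, hδ'⟩ : ∃ δ : ℝ, 0 < δ ∧ δ ≤ v a - O 0 a ∧ δ ≤ O 0 b ∧
      (O 0 a + δ = v a ∨ O 0 b - δ = 0) := by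
    rcases le_total (v a - O 0 a) (O 0 b) with h | h
    · exact ⟨v a - O 0 a, by linarith, le_rfl, h, Or.inl (by ring)⟩
    · exact ⟨O 0 b, hb, h, le_rfl, Or.inr (by ring)⟩
  have hmem : O + δ • exchange a b ∈ transportationPolytope u v := by
    apply add_exchange_mem hO.1 hab
    · linarith [fst_row_nonneg hO.1 a]
    · linarith
    · linarith
    · linarith [fst_row_le hO.1 b]
  have ea : (O + δ • exchange a b) 0 a = O 0 a + δ := by
    simp [exchange_zero_left hab]
  have eb : (O + δ • exchange a b) 0 b = O 0 b - δ := by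
    simp [exchange_zero_right hab, sub_eq_add_neg]
  have ej : ∀ j, j ≠ a → j ≠ b → (O + δ • exchange a b) 0 j = O 0 j := by
    intro j hja hjb
    simp [exchange_zero_of_ne hja hjb]
  have hj : ∀ j, j ≠ a → j ≠ b → AtBound v (O + δ • exchange a b) j := by
    intro j hja hjb
    unfold AtBound
    rw [ej j hja hjb]
    exact h j hja hjb
  have hext : O + δ • exchange a b ∈ (transportationPolytope u v).extremePoints ℝ := by
    rcases hδ' with h1 | h1
    · refine mem_extremePoints_of_atBound hmem b fun j hjb => ?_
      by_cases hja : j = a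
      · subst hja; exact Or.inr (ea.trans h1)
      · exact hj j hja hjb
    · refine mem_extremePoints_of_atBound hmem a fun j hja => ?_
      by_cases hjb : j = b
      · subst hjb; exact Or.inl (eb.trans h1)
      · exact hj j hja hjb
  refine ⟨⟨_, hext⟩, adj_of_eq_off ?_ hab fun j hja hjb => ⟨(ej j hja hjb).symm, h j hja hjb⟩,
    ej, ?_, ?_, ?_⟩
  · intro e
    have e1 := congrFun (congrFun (congrArg Subtype.val e) 0) a
    simp only [ea] at e1
    linarith
  · simp only [ea]; linarith
  · simp only [ea, eb]; ring
  · simpa only [ea, eb] using hδ'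

/-! ### The potential of a vertex relative to a target -/

/-- The columns other than the pivot `g` in which `y` differs from the target `F`. -/
noncomputable def wrongCols (F : Matrix (Fin 2) (Fin n) ℝ) (g : Fin n)
    (y : Matrix (Fin 2) (Fin n) ℝ) : Finset (Fin n) :=
  open Classical in {j | j ≠ g ∧ y 0 j ≠ F 0 j}

/-- A walk from `y` to the target may need one step that brings no column to its target value.
This happens only if the pivot `g` is fractional at `y` but is able to reach a bound, while flow
has to be both added to and removed from the other columns. -/
def NeedsDetour (u : Fin 2 → ℝ) (v : Fin n → ℝ) (F : Matrix (Fin 2) (Fin n) ℝ) (g : Fin n)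
    (y : Matrix (Fin 2) (Fin n) ℝ) : Prop :=
  ¬ AtBound v y g ∧ (∃ a, a ≠ g ∧ y 0 a < F 0 a) ∧ (∃ b, b ≠ g ∧ F 0 b < y 0 b) ∧
    ¬ ((0, g) ∈ criticalEdges u v ∧ (1, g) ∈ criticalEdges u v)

/-- The number of steps that suffice for reaching the target `F` from `y`. -/
noncomputable def potential (u : Fin 2 → ℝ) (v : Fin n → ℝ) (F : Matrix (Fin 2) (Fin n) ℝ)
    (g : Fin n) (y : Matrix (Fin 2) (Fin n) ℝ) : ℕ :=
  (wrongCols F g y).card + open Classical in if NeedsDetour u v F g y then 1 else 0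

lemma mem_wrongCols {F y : Matrix (Fin 2) (Fin n) ℝ} {g j : Fin n} :
    j ∈ wrongCols F g y ↔ j ≠ g ∧ y 0 j ≠ F 0 j := by
  simp [wrongCols]

lemma potential_lt_of_wrongCols_ssubset {F y z : Matrix (Fin 2) (Fin n) ℝ} {g : Fin n}
    (h : wrongCols F g z ⊂ wrongCols F g y)
    (hd : NeedsDetour u v F g z → NeedsDetour u v F g y) :
    potential u v F g z < potential u v F g y := by
  have := Finset.card_lt_card h
  unfold potential
  split_ifs with h1 h2 h2
  · omega
  · exact absurd (hd h1) h2
  · omega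
  · omega

lemma potential_lt_of_needsDetour {F y z : Matrix (Fin 2) (Fin n) ℝ} {g : Fin n}
    (h : wrongCols F g z ⊆ wrongCols F g y)
    (hz : ¬ NeedsDetour u v F g z) (hy : NeedsDetour u v F g y) :
    potential u v F g z < potential u v F g y := by
  have := Finset.card_le_card h
  unfold potential
  rw [if_neg hz, if_pos hy]
  omega

/-- One move from column `b` to column `a` shrinks the set of wrong columns strictly, if it brings
one of the two to its target value and both were wrong or the pivot. -/
lemma wrongCols_ssubset {F y z : Matrix (Fin 2) (Fin n) ℝ} {g a b : Fin n}
    (h : ∀ j, j ≠ a → j ≠ b → z 0 j = y 0 j)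
    (ha : a = g ∨ y 0 a ≠ F 0 a) (hb : b = g ∨ y 0 b ≠ F 0 b)
    (hc : ∃ c, c ≠ g ∧ y 0 c ≠ F 0 c ∧ z 0 c = F 0 c) :
    wrongCols F g z ⊂ wrongCols F g y := by
  obtain ⟨c, hcg, hyc, hzc⟩ := hc
  refine Finset.ssubset_iff_subset_ne.2 ⟨fun j hj => ?_, fun e => ?_⟩
  · rw [mem_wrongCols] at hj ⊢
    refine ⟨hj.1, ?_⟩
    by_cases hja : j = a
    · subst hja; exact ha.resolve_left hj.1
    by_cases hjb : j = b
    · subst hjb; exact hb.resolve_left hj.1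
    rw [← h j hja hjb]; exact hj.2
  · have : c ∈ wrongCols F g z := by rw [e]; exact mem_wrongCols.2 ⟨hcg, hyc⟩
    exact (mem_wrongCols.1 this).2 hzc

lemma fst_row_sub_eq_sum {y z : Matrix (Fin 2) (Fin n) ℝ}
    (hy : y ∈ transportationPolytope u v) (hz : z ∈ transportationPolytope u v) (g : Fin n) :
    y 0 g - z 0 g = ∑ j ∈ Finset.univ.erase g, (z 0 j - y 0 j) := by
  have h1 := hy.1 0
  rw [← hz.1 0, ← Finset.add_sum_erase _ _ (Finset.mem_univ g),
    ← Finset.add_sum_erase _ (z 0) (Finset.mem_univ g)] at h1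
  rw [Finset.sum_sub_distrib]
  linarith

/-- A step of the walk: every vertex other than the target `F` has a neighbour of smaller
potential, whose columns other than the pivot are not further away from the target. -/
lemma exists_adj_potential_lt {F : Matrix (Fin 2) (Fin n) ℝ}
    (hF : F ∈ transportationPolytope u v) {g : Fin n} (hFg : ∀ j, j ≠ g → AtBound v F j)
    (O : (transportationPolytope u v).extremePoints ℝ) (hOF : O.1 ≠ F) :
    ∃ O' : (transportationPolytope u v).extremePoints ℝ,
      (vertexEdgeGraph (transportationPolytope u v)).Adj O O' ∧
      potential u v F g O'.1 < potential u v F g O.1 ∧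
      ∀ j, j ≠ g → (F 0 j = v j → O.1 0 j ≤ O'.1 0 j) ∧ (F 0 j = 0 → O'.1 0 j ≤ O.1 0 j) := by
  have hO0 := fst_row_nonneg O.2.1
  have hOv := fst_row_le O.2.1
  have hF0 := fst_row_nonneg hF
  have hFv := fst_row_le hF
  -- Off the pivot, a deficient column of `O` is full in `F`, and a surplus column is empty.
  have hdef : ∀ a, a ≠ g → O.1 0 a < F 0 a → F 0 a = v a := fun a ha h =>
    (hFg a ha).resolve_left fun h0 => by linarith [hO0 a]
  have hsur : ∀ b, b ≠ g → F 0 b < O.1 0 b → F 0 b = 0 := fun b hb h =>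
    (hFg b hb).resolve_right fun h0 => by linarith [hOv b]
  have hone : ∀ {f}, ¬ AtBound v O.1 f → ∀ j, j ≠ f → AtBound v O.1 j := fun hf j hj =>
    atBound_of_extreme O.2 hf hj
  -- The direction condition holds for every move between suitable columns.
  have hdir : ∀ (O' : (transportationPolytope u v).extremePoints ℝ) (a b : Fin n),
      (∀ j, j ≠ a → j ≠ b → O'.1 0 j = O.1 0 j) → O.1 0 a < O'.1 0 a →
      O'.1 0 a + O'.1 0 b = O.1 0 a + O.1 0 b →
      (a = g ∨ O.1 0 a < F 0 a) → (b = g ∨ F 0 b < O.1 0 b) →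
      ∀ j, j ≠ g → (F 0 j = v j → O.1 0 j ≤ O'.1 0 j) ∧ (F 0 j = 0 → O'.1 0 j ≤ O.1 0 j) := by
    intro O' a b hj hlt hadd ha hb j hjg
    by_cases hja : j = a
    · subst hja
      have := ha.resolve_left hjg
      exact ⟨fun _ => hlt.le, fun h0 => by linarith [hO0 j]⟩
    by_cases hjb : j = b
    · subst hjb
      have := hb.resolve_left hjg
      exact ⟨fun h0 => by linarith [hOv j], fun _ => by linarith⟩
    rw [hj j hja hjb]
    exact ⟨fun _ => le_rfl, fun _ => le_rfl⟩
  by_cases hD : ∃ a, a ≠ g ∧ O.1 0 a < F 0 a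
  · by_cases hS : ∃ b, b ≠ g ∧ F 0 b < O.1 0 b
    · by_cases hg : AtBound v O.1 g
      · -- The pivot is at a bound: move flow from a surplus to a deficient column, one of which
        -- is the fractional column if there is one.
        obtain ⟨a, b, hag, ha, hbg, hb, hab⟩ : ∃ a b, a ≠ g ∧ O.1 0 a < F 0 a ∧ b ≠ g ∧
            F 0 b < O.1 0 b ∧ ∀ j, j ≠ a → j ≠ b → AtBound v O.1 j := by
          obtain ⟨a, hag, ha⟩ := hD
          obtain ⟨b, hbg, hb⟩ := hS
          by_cases hf : ∃ f, ¬ AtBound v O.1 f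
          · obtain ⟨f, hf⟩ := hf
            have hfg : f ≠ g := fun e => hf (e ▸ hg)
            have hf' := (not_atBound_iff O.2.1).1 hf
            rcases hFg f hfg with h0 | h0
            · exact ⟨a, f, hag, ha, hfg, by rw [h0]; exact hf'.1, fun j _ hj => hone hf j hj⟩
            · exact ⟨f, b, hfg, by rw [h0]; exact hf'.2, hbg, hb, fun j hj _ => hone hf j hj⟩
          · push Not at hf
            exact ⟨a, b, hag, ha, hbg, hb, fun j _ _ => hf j⟩
        have hne : a ≠ b := by rintro rfl; linarith
        have hFa := hdef a hag ha
        have hFb := hsur b hbg hb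
        obtain ⟨O', hadj, hj, hlt, hadd, hfin⟩ := exists_adj_move O hne (hFa ▸ ha) (hFb ▸ hb) hab
        refine ⟨O', hadj, potential_lt_of_wrongCols_ssubset
          (wrongCols_ssubset hj (Or.inr ha.ne) (Or.inr hb.ne') ?_) ?_,
          hdir O' a b hj hlt hadd (Or.inr ha) (Or.inr hb)⟩
        · rcases hfin with h | h
          · exact ⟨a, hag, ha.ne, by rw [h, hFa]⟩
          · exact ⟨b, hbg, hb.ne', by rw [h, hFb]⟩
        · intro h
          refine absurd ?_ h.1
          unfold AtBound
          rwa [hj g hag.symm hbg.symm]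
      · -- The pivot is fractional: it either fills a deficient column or is emptied. The latter
        -- is the only step that brings no column to its target value.
        obtain ⟨a, hag, ha⟩ := id hD
        have hFa := hdef a hag ha
        obtain ⟨O', hadj, hj, hlt, hadd, hfin⟩ := exists_adj_move O hag (hFa ▸ ha)
          ((not_atBound_iff O.2.1).1 hg).1 (fun j _ hj => hone hg j hj)
        refine ⟨O', hadj, ?_, hdir O' a g hj hlt hadd (Or.inr ha) (Or.inl rfl)⟩
        rcases hfin with h | h
        · exact potential_lt_of_wrongCols_ssubset
            (wrongCols_ssubset hj (Or.inr ha.ne) (Or.inl rfl) ⟨a, hag, ha.ne, by rw [h, hFa]⟩)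
            fun hd => ⟨hg, hD, hS, hd.2.2.2⟩
        · refine potential_lt_of_needsDetour (fun j hj' => ?_) (fun hd => hd.1 (Or.inl h))
            ⟨hg, hD, hS, fun hc => (hc.1 O'.1 O'.2.1).ne' h⟩
          rw [mem_wrongCols] at hj' ⊢
          refine ⟨hj'.1, ?_⟩
          by_cases hja : j = a
          · subst hja; exact ha.ne
          · rw [← hj j hja hj'.1]; exact hj'.2
    · -- Without surplus columns, the pivot holds enough flow to fill any deficient column.
      push Not at hS
      obtain ⟨a, hag, ha, hab⟩ : ∃ a, a ≠ g ∧ O.1 0 a < F 0 a ∧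
          ∀ j, j ≠ a → j ≠ g → AtBound v O.1 j := by
        obtain ⟨a, hag, ha⟩ := hD
        by_cases hf : ∃ f, f ≠ g ∧ ¬ AtBound v O.1 f
        · obtain ⟨f, hfg, hf⟩ := hf
          have hf' := (not_atBound_iff O.2.1).1 hf
          refine ⟨f, hfg, (hS f hfg).lt_of_ne fun e => hf ?_, fun j hj _ => hone hf j hj⟩
          unfold AtBound
          rw [e]
          exact hFg f hfg
        · push Not at hf
          exact ⟨a, hag, ha, fun j _ hj => hf j hj⟩
      have hFa := hdef a hag ha
      have hgle : F 0 a - O.1 0 a ≤ O.1 0 g - F 0 g := by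
        rw [fst_row_sub_eq_sum O.2.1 hF]
        exact Finset.single_le_sum (f := fun j => F 0 j - O.1 0 j)
          (fun j hj => sub_nonneg.2 (hS j (Finset.ne_of_mem_erase hj))) (by simp [hag])
      obtain ⟨O', hadj, hj, hlt, hadd, hfin⟩ := exists_adj_move O hag (hFa ▸ ha)
        (by linarith [hF0 g]) hab
      have h : O'.1 0 a = v a := by
        rcases hfin with h | h
        · exact h
        · linarith [hF0 g, fst_row_le O'.2.1 a]
      refine ⟨O', hadj, potential_lt_of_wrongCols_ssubset
        (wrongCols_ssubset hj (Or.inr ha.ne) (Or.inl rfl) ⟨a, hag, ha.ne, by rw [h, hFa]⟩)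
        (fun hd => ?_), hdir O' a g hj hlt hadd (Or.inr ha) (Or.inl rfl)⟩
      obtain ⟨b, hbg, hb⟩ := hd.2.2.1
      by_cases hba : b = a
      · subst hba; linarith
      · rw [hj b hba hbg] at hb
        linarith [hS b hbg]
  · push Not at hD
    by_cases hS : ∃ b, b ≠ g ∧ F 0 b < O.1 0 b
    · -- Without deficient columns, the pivot has enough room to empty any surplus column.
      obtain ⟨b, hbg, hb, hab⟩ : ∃ b, b ≠ g ∧ F 0 b < O.1 0 b ∧
          ∀ j, j ≠ g → j ≠ b → AtBound v O.1 j := by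
        obtain ⟨b, hbg, hb⟩ := hS
        by_cases hf : ∃ f, f ≠ g ∧ ¬ AtBound v O.1 f
        · obtain ⟨f, hfg, hf⟩ := hf
          refine ⟨f, hfg, (hD f hfg).lt_of_ne fun e => hf ?_, fun j _ hj => hone hf j hj⟩
          unfold AtBound
          rw [← e]
          exact hFg f hfg
        · push Not at hf
          exact ⟨b, hbg, hb, fun j hj _ => hf j hj⟩
      have hFb := hsur b hbg hb
      have hgle : O.1 0 b - F 0 b ≤ F 0 g - O.1 0 g := by
        rw [fst_row_sub_eq_sum hF O.2.1]
        exact Finset.single_le_sum (f := fun j => O.1 0 j - F 0 j)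
          (fun j hj => sub_nonneg.2 (hD j (Finset.ne_of_mem_erase hj))) (by simp [hbg])
      obtain ⟨O', hadj, hj, hlt, hadd, hfin⟩ := exists_adj_move O hbg.symm
        (by linarith [hFv g]) (hFb ▸ hb) hab
      have h : O'.1 0 b = 0 := by
        rcases hfin with h | h
        · linarith [hFv g, fst_row_nonneg O'.2.1 b]
        · exact h
      refine ⟨O', hadj, potential_lt_of_wrongCols_ssubset
        (wrongCols_ssubset hj (Or.inl rfl) (Or.inr hb.ne') ⟨b, hbg, hb.ne', by rw [h, hFb]⟩)
        (fun hd => ?_), hdir O' g b hj hlt hadd (Or.inl rfl) (Or.inr hb)⟩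
      obtain ⟨a, hag, ha⟩ := hd.2.1
      by_cases hba : a = b
      · subst hba; linarith
      · rw [hj a hag hba] at ha
        linarith [hD a hag]
    · push Not at hS
      exact absurd (eq_of_fst_row_eq_off O.2.1 hF g fun j hj =>
        le_antisymm (hS j hj) (hD j hj)) hOF

/-- Every vertex is joined to the target by a walk no longer than its potential, along which the
columns other than the pivot only ever move towards the target. -/
lemma exists_walk_length_le_potential (F : (transportationPolytope u v).extremePoints ℝ)
    {g : Fin n} (hFg : ∀ j, j ≠ g → AtBound v F.1 j)
    (O : (transportationPolytope u v).extremePoints ℝ) :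
    ∃ p : (vertexEdgeGraph (transportationPolytope u v)).Walk O F,
      p.length ≤ potential u v F.1 g O.1 ∧
      ∀ d ∈ p.darts, ∀ j, j ≠ g →
        (F.1 0 j = v j → d.fst.1 0 j ≤ d.snd.1 0 j) ∧
        (F.1 0 j = 0 → d.snd.1 0 j ≤ d.fst.1 0 j) := by
  induction hN : potential u v F.1 g O.1 using Nat.strong_induction_on generalizing O with
  | _ N ih =>
    by_cases hOF : O = F
    · subst hOF
      exact ⟨.nil, by simp, by simp⟩
    · obtain ⟨O', hadj, hlt, hdir⟩ := exists_adj_potential_lt F.2.1 hFg O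
        (fun e => hOF (Subtype.ext e))
      obtain ⟨p, hp, hpd⟩ := ih _ (hN ▸ hlt) O' rfl
      refine ⟨.cons hadj p, ?_, ?_⟩
      · rw [SimpleGraph.Walk.length_cons]; omega
      · intro d hd
        rw [SimpleGraph.Walk.darts_cons, List.mem_cons] at hd
        rcases hd with rfl | hd
        · exact hdir
        · exact hpd d hd

/-! ### Counting critical edges -/

lemma potential_eq_sum (F y : Matrix (Fin 2) (Fin n) ℝ) (g : Fin n) :
    potential u v F g y = ∑ j, open Classical in ((if j ≠ g ∧ y 0 j ≠ F 0 j then 1 else 0) +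
      if j = g then (if NeedsDetour u v F g y then 1 else 0) else 0) := by
  rw [Finset.sum_add_distrib, Finset.sum_ite_eq' Finset.univ g, if_pos (Finset.mem_univ g),
    ← Finset.card_filter]
  rfl

lemma potential_le (F y : Matrix (Fin 2) (Fin n) ℝ) (g : Fin n) :
    potential u v F g y ≤ n := by
  classical
  calc potential u v F g y ≤ ∑ j : Fin n, 1 := by
        rw [potential_eq_sum]
        refine Finset.sum_le_sum fun j _ => ?_
        by_cases hj : j = g
        · simp only [hj, ne_eq, not_true, false_and, if_false, if_true]
          split_ifs <;> simp
        · simp only [hj, if_false, add_zero]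
          split_ifs <;> simp
    _ = n := by simp

lemma ncard_criticalEdges : (criticalEdges u v).ncard = ∑ j, open Classical in
    ((if (0, j) ∈ criticalEdges u v then 1 else 0) +
      if (1, j) ∈ criticalEdges u v then 1 else 0) := by
  classical
  rw [Set.ncard_eq_toFinset_card', ← Set.filter_mem_univ_eq_toFinset, Finset.card_filter,
    Fintype.sum_prod_type_right]
  simp only [Fin.sum_univ_two]

lemma zero_notMem_criticalEdges {y : Matrix (Fin 2) (Fin n) ℝ}
    (hy : y ∈ transportationPolytope u v) {j : Fin n} (h : y 0 j = 0) :
    (0, j) ∉ criticalEdges u v := fun hc => (hc y hy).ne' h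

lemma one_notMem_criticalEdges {y : Matrix (Fin 2) (Fin n) ℝ}
    (hy : y ∈ transportationPolytope u v) {j : Fin n} (h : y 0 j = v j) :
    (1, j) ∉ criticalEdges u v := fun hc => (hc y hy).ne' (by
  simp only [snd_row_eq hy, h, sub_self])

/-- The contributions of each column to the potential and to the critical edges (with a detour
counted at the pivot) add up to at most one, and to at most two in the only column where the vertex
may be fractional. -/
lemma potential_add_ncard_criticalEdges_le {F y : Matrix (Fin 2) (Fin n) ℝ}
    (hF : F ∈ transportationPolytope u v) {g : Fin n} (hFg : ∀ j, j ≠ g → AtBound v F j)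
    (hy : y ∈ (transportationPolytope u v).extremePoints ℝ) :
    potential u v F g y + (criticalEdges u v).ncard ≤ n + 1 := by
  classical
  have hfrac : ∑ j, (if AtBound v y j then 0 else 1) ≤ 1 := by
    by_cases h : ∃ f, ¬ AtBound v y f
    · obtain ⟨f, hf⟩ := h
      rw [Finset.sum_eq_single f (fun j _ hj => if_pos (atBound_of_extreme hy hf hj)) (by simp), if_neg hf]
    · push Not at h
      simp [h]
  have hcol : ∀ j, (((if j ≠ g ∧ y 0 j ≠ F 0 j then 1 else 0) +
      if j = g then (if NeedsDetour u v F g y then 1 else 0) else 0) +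
      ((if (0, j) ∈ criticalEdges u v then 1 else 0) +
        if (1, j) ∈ criticalEdges u v then 1 else 0)) ≤ 1 + if AtBound v y j then 0 else 1 := by
    intro j
    have h0y := zero_notMem_criticalEdges hy.1 (j := j)
    have h1y := one_notMem_criticalEdges hy.1 (j := j)
    have h0F := zero_notMem_criticalEdges hF (j := j)
    have h1F := one_notMem_criticalEdges hF (j := j)
    by_cases hj : j = g
    · subst hj
      by_cases hb : AtBound v y j
      · have hd : ¬ NeedsDetour u v F j y := fun h => h.1 hb
        rcases id hb with h | h
        · simp only [hd, hb, h0y h]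
          split_ifs <;> simp_all
        · simp only [hd, hb, h1y h]
          split_ifs <;> simp_all
      · by_cases hd : NeedsDetour u v F j y
        · have := hd.2.2.2
          split_ifs <;> simp_all
        · split_ifs <;> simp_all
    · simp only [hj, if_false, ne_eq, not_false_eq_true, true_and, add_zero]
      by_cases hb : AtBound v y j
      · rcases id hb with h | h <;> rcases hFg j hj with h' | h' <;> split_ifs <;> simp_all
      · rcases hFg j hj with h' | h' <;> split_ifs <;> simp_all
  have := Finset.sum_le_sum fun j (_ : j ∈ Finset.univ) => hcol j
  rw [Finset.sum_add_distrib, ← potential_eq_sum, ← ncard_criticalEdges,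
    Finset.sum_add_distrib] at this
  simp only [Finset.sum_const, Finset.card_univ, Fintype.card_fin, smul_eq_mul, mul_one] at this
  omega

end Walk

section Bounds

variable {n : ℕ} {u : Fin 2 → ℝ} {v : Fin n → ℝ}

/-! ### Greedy maximizers -/

/-- The greedy filling of the columns in `T` in the order of decreasing `t`: apart from a pivot
column, every column is full or empty, according to how its `t`-value compares with the pivot's. -/
lemma exists_greedy (hv : ∀ j, 0 < v j) (t : Fin n → ℝ) (T : Finset (Fin n)) (hT : T.Nonempty)
    (c : ℝ) (hc : 0 ≤ c) (hcT : c ≤ ∑ j ∈ T, v j) :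
    ∃ (x : Fin n → ℝ) (g : Fin n), ∑ j ∈ T, x j = c ∧ (∀ j, 0 ≤ x j ∧ x j ≤ v j) ∧
      ∀ j ∈ T, j ≠ g → (x j = v j ∧ t g ≤ t j) ∨ (x j = 0 ∧ t j ≤ t g) := by
  suffices h : T.Nonempty → ∀ c, 0 ≤ c → c ≤ ∑ j ∈ T, v j → ∃ (x : Fin n → ℝ) (g : Fin n),
      g ∈ T ∧ ∑ j ∈ T, x j = c ∧ (∀ j, 0 ≤ x j ∧ x j ≤ v j) ∧
      ∀ j ∈ T, j ≠ g → (x j = v j ∧ t g ≤ t j) ∨ (x j = 0 ∧ t j ≤ t g) by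
    obtain ⟨x, g, -, h⟩ := h hT c hc hcT
    exact ⟨x, g, h⟩
  clear hT hc hcT c
  induction T using Finset.induction_on_max_value t with
  | empty => exact fun h => absurd h Finset.not_nonempty_empty
  | insert a s ha hmax ih =>
    intro _ c hc hcT
    rw [Finset.sum_insert ha] at hcT
    by_cases hca : c ≤ v a
    · refine ⟨Pi.single a c, a, Finset.mem_insert_self _ _, ?_, fun j => ?_, fun j hj hja => ?_⟩
      · simp
      · by_cases hja : j = a
        · subst hja; simp [hc, hca]
        · simp [hja, (hv j).le]
      · exact Or.inr ⟨by simp [hja], hmax j (Finset.mem_of_mem_insert_of_ne hj hja)⟩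
    · push Not at hca
      have hs : s.Nonempty := by
        by_contra hs
        rw [Finset.not_nonempty_iff_eq_empty] at hs
        subst hs
        rw [Finset.sum_empty] at hcT
        linarith
      obtain ⟨x, g, hg, hsum, hx, hxg⟩ := ih hs (c - v a) (by linarith) (by linarith)
      refine ⟨Function.update x a (v a), g, Finset.mem_insert_of_mem hg, ?_, fun j => ?_,
        fun j hj hjg => ?_⟩
      · rw [Finset.sum_insert ha, Finset.sum_update_of_notMem ha, hsum, Function.update_self]
        ring
      · by_cases hja : j = a
        · subst hja; simp [(hv j).le]
        · simpa [hja] using hx j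
      · by_cases hja : j = a
        · subst hja
          exact Or.inl ⟨by simp, hmax g hg⟩
        · simpa [hja] using hxg j (Finset.mem_of_mem_insert_of_ne hj hja) hjg

/-- As the first row sums agree, the objective depends only on the differences
`s 0 j - s 1 j`, normalized at any column `g`. -/
lemma objective_sub_objective (s : Matrix (Fin 2) (Fin n) ℝ) {y z : Matrix (Fin 2) (Fin n) ℝ}
    (hy : y ∈ transportationPolytope u v) (hz : z ∈ transportationPolytope u v) (g : Fin n) :
    objective s z - objective s y =
      ∑ j, ((s 0 j - s 1 j) - (s 0 g - s 1 g)) * (z 0 j - y 0 j) := by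
  have h : ∑ j, (s 0 g - s 1 g) * (z 0 j - y 0 j) = 0 := by
    rw [← Finset.mul_sum, Finset.sum_sub_distrib, hy.1, hz.1, sub_self, mul_zero]
  simp only [objective, Fin.sum_univ_two, snd_row_eq hy, snd_row_eq hz]
  rw [← sub_zero (_ - _), ← h]
  simp only [← Finset.sum_add_distrib, ← Finset.sum_sub_distrib]
  exact Finset.sum_congr rfl fun j _ => by ring

lemma objective_le_of_towards (s : Matrix (Fin 2) (Fin n) ℝ) {F y z : Matrix (Fin 2) (Fin n) ℝ}
    {g : Fin n} (hF : ∀ j, j ≠ g → (F 0 j = v j ∧ s 0 g - s 1 g ≤ s 0 j - s 1 j) ∨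
      (F 0 j = 0 ∧ s 0 j - s 1 j ≤ s 0 g - s 1 g))
    (hy : y ∈ transportationPolytope u v) (hz : z ∈ transportationPolytope u v)
    (h : ∀ j, j ≠ g → (F 0 j = v j → y 0 j ≤ z 0 j) ∧ (F 0 j = 0 → z 0 j ≤ y 0 j)) :
    objective s y ≤ objective s z := by
  rw [← sub_nonneg, objective_sub_objective s hy hz g]
  refine Finset.sum_nonneg fun j _ => ?_
  by_cases hj : j = g
  · subst hj; simp
  · rcases hF j hj with ⟨h1, h2⟩ | ⟨h1, h2⟩
    · exact mul_nonneg (sub_nonneg.2 h2) (sub_nonneg.2 ((h j hj).1 h1))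
    · exact mul_nonneg_of_nonpos_of_nonpos (sub_nonpos.2 h2) (sub_nonpos.2 ((h j hj).2 h1))

/-- For every cost vector there is a vertex at which, apart from a pivot column, every column is
full or empty according to how its cost difference compares with the pivot's. -/
lemma exists_greedy_vertex [NeZero n] (hu : ∀ i, 0 < u i) (hv : ∀ j, 0 < v j)
    (hsum : ∑ i, u i = ∑ j, v j) (s : Matrix (Fin 2) (Fin n) ℝ) :
    ∃ (F : (transportationPolytope u v).extremePoints ℝ) (g : Fin n), ∀ j, j ≠ g →
      (F.1 0 j = v j ∧ s 0 g - s 1 g ≤ s 0 j - s 1 j) ∨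
        (F.1 0 j = 0 ∧ s 0 j - s 1 j ≤ s 0 g - s 1 g) := by
  obtain ⟨x, g, hxc, hx, hxg⟩ := exists_greedy hv (fun j => s 0 j - s 1 j) Finset.univ
    ⟨0, Finset.mem_univ _⟩ (u 0) (hu 0).le (by
      rw [← hsum, Fin.sum_univ_two]; linarith [hu 1])
  have hmem := mem_of_fst_row hsum x hxc (fun j => (hx j).1) fun j => (hx j).2
  refine ⟨⟨_, mem_extremePoints_of_atBound hmem g fun j hj => ?_⟩, g, fun j hj => ?_⟩
  · rcases hxg j (Finset.mem_univ j) hj with h | h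
    · exact Or.inr h.1
    · exact Or.inl h.1
  · simpa using hxg j (Finset.mem_univ j) hj

lemma exists_monotone_walk [NeZero n] (hu : ∀ i, 0 < u i) (hv : ∀ j, 0 < v j)
    (hsum : ∑ i, u i = ∑ j, v j) (s : Matrix (Fin 2) (Fin n) ℝ)
    (O : (transportationPolytope u v).extremePoints ℝ) :
    ∃ (F : (transportationPolytope u v).extremePoints ℝ)
      (p : (vertexEdgeGraph (transportationPolytope u v)).Walk O F),
      IsMaxOn (objective s) (transportationPolytope u v) F.1 ∧
      IsMonotoneWalk s p ∧
      p.length ≤ n ∧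
      p.length + (criticalEdges u v).ncard ≤ n + 1 := by
  obtain ⟨F, g, hF⟩ := exists_greedy_vertex hu hv hsum s
  have hFg : ∀ j, j ≠ g → AtBound v F.1 j := fun j hj =>
    (hF j hj).elim (fun h => Or.inr h.1) fun h => Or.inl h.1
  obtain ⟨p, hp, hpd⟩ := exists_walk_length_le_potential F hFg O
  refine ⟨F, p, fun y hy => ?_, fun d hd => ?_, hp.trans (potential_le _ _ _), ?_⟩
  · exact objective_le_of_towards s hF hy F.2.1 fun j _ =>
      ⟨fun h => h ▸ fst_row_le hy j, fun h => h ▸ fst_row_nonneg hy j⟩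
  · exact objective_le_of_towards s hF d.fst.2.1 d.snd.2.1 (hpd d hd)
  · have := potential_add_ncard_criticalEdges_le F.2.1 hFg O.2
    omega

/-! ### The diameter bounds -/

lemma ediam_le [NeZero n] :
    (vertexEdgeGraph (transportationPolytope u v)).ediam ≤ n := by
  refine SimpleGraph.ediam_le_of_edist_le fun O F => ?_
  obtain ⟨g, hFg⟩ := exists_forall_ne_atBound F.2
  obtain ⟨p, hp, -⟩ := exists_walk_length_le_potential F hFg O
  exact (SimpleGraph.edist_le p).trans (by exact_mod_cast hp.trans (potential_le _ _ _))

lemma ediam_add_ncard_criticalEdges_le [NeZero n] (hu : ∀ i, 0 < u i) (hv : ∀ j, 0 < v j)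
    (hsum : ∑ i, u i = ∑ j, v j) :
    (vertexEdgeGraph (transportationPolytope u v)).ediam + (criticalEdges u v).ncard ≤ n + 1 := by
  obtain ⟨F, -⟩ := exists_greedy_vertex hu hv hsum 0
  have : Nonempty ((transportationPolytope u v).extremePoints ℝ) := ⟨F⟩
  have htop : (vertexEdgeGraph (transportationPolytope u v)).ediam ≠ ⊤ := fun h => by
    have := ediam_le (u := u) (v := v)
    rw [h, top_le_iff] at this
    exact ENat.natCast_ne_top n this
  obtain ⟨O, F, hOF⟩ := SimpleGraph.exists_edist_eq_ediam_of_ne_top htop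
  obtain ⟨g, hFg⟩ := exists_forall_ne_atBound F.2
  obtain ⟨p, hp, -⟩ := exists_walk_length_le_potential F hFg O
  have := potential_add_ncard_criticalEdges_le F.2.1 hFg O.2
  rw [← hOF]
  calc _ ≤ (p.length : ℕ∞) + (criticalEdges u v).ncard := by
        gcongr
        exact SimpleGraph.edist_le p
    _ ≤ n + 1 := by
        have h : p.length + (criticalEdges u v).ncard ≤ n + 1 := by omega
        exact_mod_cast h

/-! ### Tightness -/

/-- In a nondegenerate polytope, an edge corrects at most one column besides the pivot. -/
lemma card_wrongCols_le_of_adj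
    (hnd : ∀ y ∈ transportationPolytope u v, ∃ j, ¬ AtBound v y j)
    {F : Matrix (Fin 2) (Fin n) ℝ} {g : Fin n} (hFg : ∀ j, j ≠ g → AtBound v F j)
    {y z : (transportationPolytope u v).extremePoints ℝ}
    (h : (vertexEdgeGraph (transportationPolytope u v)).Adj y z) :
    (wrongCols F g y.1).card ≤ (wrongCols F g z.1).card + 1 := by
  obtain ⟨a, b, hab, hj⟩ := exists_eq_off_of_adj h
  have key : ∃ c, wrongCols F g y.1 ⊆ insert c (wrongCols F g z.1) := by
    by_cases ha : a ∈ wrongCols F g y.1 → a ∈ wrongCols F g z.1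
    · refine ⟨b, fun j hjy => ?_⟩
      by_cases hjb : j = b
      · simp [hjb]
      by_cases hja : j = a
      · subst hja; exact Finset.mem_insert_of_mem (ha hjy)
      · refine Finset.mem_insert_of_mem ?_
        rw [mem_wrongCols] at hjy ⊢
        rwa [← (hj j hja hjb).1]
    by_cases hb : b ∈ wrongCols F g y.1 → b ∈ wrongCols F g z.1
    · refine ⟨a, fun j hjy => ?_⟩
      by_cases hja : j = a
      · simp [hja]
      by_cases hjb : j = b
      · subst hjb; exact Finset.mem_insert_of_mem (hb hjy)
      · refine Finset.mem_insert_of_mem ?_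
        rw [mem_wrongCols] at hjy ⊢
        rwa [← (hj j hja hjb).1]
    -- If both columns of the edge were corrected, all columns of `z` would be at a bound.
    exfalso
    push Not at ha hb
    obtain ⟨ha1, ha2⟩ := ha
    obtain ⟨hb1, hb2⟩ := hb
    rw [mem_wrongCols] at ha1 ha2 hb1 hb2
    have ha3 : z.1 0 a = F 0 a := by
      by_contra hne; exact ha2 ⟨ha1.1, hne⟩
    have hb3 : z.1 0 b = F 0 b := by
      by_contra hne; exact hb2 ⟨hb1.1, hne⟩
    obtain ⟨f, hf⟩ := hnd z.1 z.2.1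
    apply hf
    unfold AtBound
    by_cases hfa : f = a
    · subst hfa; rw [ha3]; exact hFg f ha1.1
    by_cases hfb : f = b
    · subst hfb; rw [hb3]; exact hFg f hb1.1
    · rw [← (hj f hfa hfb).1]; exact (hj f hfa hfb).2
  obtain ⟨c, hc⟩ := key
  exact (Finset.card_le_card hc).trans (Finset.card_insert_le _ _)

lemma card_wrongCols_le_length
    (hnd : ∀ y ∈ transportationPolytope u v, ∃ j, ¬ AtBound v y j) {g : Fin n}
    {y F : (transportationPolytope u v).extremePoints ℝ} (hFg : ∀ j, j ≠ g → AtBound v F.1 j)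
    (p : (vertexEdgeGraph (transportationPolytope u v)).Walk y F) :
    (wrongCols F.1 g y.1).card ≤ p.length := by
  induction p with
  | nil => simp [wrongCols]
  | cons h p ih =>
    have := card_wrongCols_le_of_adj hnd hFg h
    have := ih hFg
    rw [SimpleGraph.Walk.length_cons]
    omega

/-- If the pivot is fractional at `O` and too small to fill or empty another column on its own,
and `O` and `F` are opposite in all the other columns, then the first step out of `O` corrects
nothing, so that `n` steps are necessary. -/
lemma le_length_of_opposite (hn : 2 ≤ n)
    (hnd : ∀ y ∈ transportationPolytope u v, ∃ j, ¬ AtBound v y j) {g : Fin n}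
    (hg : ∀ j, j ≠ g → v g < v j) {O F : (transportationPolytope u v).extremePoints ℝ}
    (hO : ¬ AtBound v O.1 g)
    (hOF : ∀ j, j ≠ g → (O.1 0 j = 0 ∧ F.1 0 j = v j) ∨ (O.1 0 j = v j ∧ F.1 0 j = 0))
    (p : (vertexEdgeGraph (transportationPolytope u v)).Walk O F) : n ≤ p.length := by
  have hFg : ∀ j, j ≠ g → AtBound v F.1 j := fun j hj =>
    (hOF j hj).elim (fun h => Or.inr h.2) fun h => Or.inl h.2
  have hvg : 0 < v g := by
    have := (not_atBound_iff O.2.1).1 hO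
    linarith
  have hne : ∀ j, j ≠ g → O.1 0 j ≠ F.1 0 j := by
    intro j hj e
    have := hg j hj
    rcases hOF j hj with ⟨h1, h2⟩ | ⟨h1, h2⟩ <;> rw [h1, h2] at e <;> linarith
  have hcard : (wrongCols F.1 g O.1).card = n - 1 := by
    have : wrongCols F.1 g O.1 = Finset.univ.erase g := by
      ext j
      rw [mem_wrongCols]
      simpa using hne j
    rw [this, Finset.card_erase_of_mem (Finset.mem_univ g), Finset.card_univ, Fintype.card_fin]
  cases p with
  | nil =>
    rw [wrongCols] at hcard
    simp at hcard
    omega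
  | @cons _ z _ hadj p =>
    have hp := card_wrongCols_le_length hnd hFg p
    obtain ⟨c, hcg, hcz⟩ : ∃ c, c ≠ g ∧ ∀ j, j ≠ g → j ≠ c → O.1 0 j = z.1 0 j := by
      obtain ⟨a, b, hab, hj⟩ := exists_eq_off_of_adj hadj
      by_cases hga : g = a
      · subst hga
        exact ⟨b, hab.symm, fun j h1 h2 => (hj j h1 h2).1⟩
      by_cases hgb : g = b
      · subst hgb
        exact ⟨a, hab, fun j h1 h2 => (hj j h2 h1).1⟩
      · exact absurd (hj g hga hgb).2 hO
    have hadd := fst_row_add_eq O.2.1 z.2.1 hcg.symm hcz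
    have hO' := (not_atBound_iff O.2.1).1 hO
    have hle : (wrongCols F.1 g O.1).card ≤ (wrongCols F.1 g z.1).card := by
      refine Finset.card_le_card fun j hj => ?_
      rw [mem_wrongCols] at hj ⊢
      refine ⟨hj.1, ?_⟩
      by_cases hjc : j = c
      · subst hjc
        intro e
        have := fst_row_nonneg z.2.1 g
        have := fst_row_le z.2.1 g
        have := hg j hj.1
        rcases hOF j hj.1 with ⟨h1, h2⟩ | ⟨h1, h2⟩ <;> linarith
      · rw [← hcz j hj.1 hjc]; exact hj.2
    rw [SimpleGraph.Walk.length_cons]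
    omega

/-- Margins attaining the diameter bound: a small column, one column of size `4 (m + 1)` and
`m + 1` columns of size `4`. All column sums are even while the row sums are odd, which makes
the polytope nondegenerate. -/
lemma exists_ediam_eq (m : ℕ) : ∃ (u : Fin 2 → ℝ) (v : Fin (m + 3) → ℝ),
    (∀ i, 0 < u i) ∧ (∀ j, 0 < v j) ∧ ∑ i, u i = ∑ j, v j ∧
      (vertexEdgeGraph (transportationPolytope u v)).ediam = (m + 3 : ℕ) := by
  set u : Fin 2 → ℝ := fun _ => 4 * m + 5 with hu
  set v : Fin (m + 3) → ℝ := Fin.cons 2 (Fin.cons (4 * (m + 1)) fun _ => 4) with hv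
  have hv0 : v 0 = 2 := rfl
  have hvj : ∀ j, j ≠ 0 → v 0 < v j := by
    intro j
    refine Fin.cases (fun h => absurd rfl h) (fun j _ => ?_) j
    refine Fin.cases ?_ (fun j => ?_) j
    · simp only [hv, Fin.cons_zero, Fin.cons_succ]
      have : (0 : ℝ) ≤ m := m.cast_nonneg
      linarith
    · simp only [hv, Fin.cons_zero, Fin.cons_succ]
      norm_num
  have hvpos : ∀ j, 0 < v j := by
    intro j
    by_cases hj : j = 0
    · rw [hj, hv0]; norm_num
    · linarith [hvj j hj]
  have hsum : ∑ i, u i = ∑ j, v j := by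
    simp only [hu, hv, Fin.sum_univ_succ, Fin.cons_zero, Fin.cons_succ]
    simp
    ring
  have hnd : ∀ y ∈ transportationPolytope u v, ∃ j, ¬ AtBound v y j := by
    intro y hy
    by_contra! hcon
    have he : ∀ j, ∃ e : ℕ, y 0 j = 2 * e := by
      have hve : ∀ j, ∃ e : ℕ, v j = 2 * e := by
        intro j
        refine Fin.cases ⟨1, by simp [hv]⟩ (fun j => ?_) j
        refine Fin.cases ⟨2 * (m + 1), ?_⟩ (fun j => ⟨2, ?_⟩) j
        · simp only [hv, Fin.cons_zero, Fin.cons_succ]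
          push_cast
          ring
        · simp only [hv, Fin.cons_succ]
          norm_num
      intro j
      rcases hcon j with h | h
      · exact ⟨0, by simp [h]⟩
      · rw [h]; exact hve j
    choose e he using he
    have h1 := hy.1 0
    simp only [he, ← Finset.mul_sum, hu] at h1
    have h2 : 2 * ∑ j, e j = 4 * m + 5 := by exact_mod_cast h1
    omega
  set x : Fin (m + 3) → ℝ := Fin.cons 1 (Fin.cons 0 fun _ => 4) with hx
  set w : Fin (m + 3) → ℝ := Fin.cons 1 (Fin.cons (4 * (m + 1)) fun _ => 0) with hw
  have hOmem : Matrix.of ![x, v - x] ∈ transportationPolytope u v := by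
    refine mem_of_fst_row hsum _ ?_ (fun j => ?_) fun j => ?_
    · simp only [hx, hu, Fin.sum_univ_succ, Fin.cons_zero, Fin.cons_succ]
      simp
      ring
    all_goals
      refine Fin.cases ?_ (fun j => ?_) j
      · simp [hx, hv]
      · refine Fin.cases ?_ (fun j => ?_) j
        · simp [hx, hv]
          try positivity
        · simp [hx, hv]
  have hFmem : Matrix.of ![w, v - w] ∈ transportationPolytope u v := by
    refine mem_of_fst_row hsum _ ?_ (fun j => ?_) fun j => ?_
    · simp only [hw, hu, Fin.sum_univ_succ, Fin.cons_zero, Fin.cons_succ]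
      simp
      ring
    all_goals
      refine Fin.cases ?_ (fun j => ?_) j
      · simp [hw, hv]
      · refine Fin.cases ?_ (fun j => ?_) j
        · simp [hw, hv]
          try positivity
        · simp [hw, hv]
  set O := Matrix.of ![x, v - x] with hO
  set F := Matrix.of ![w, v - w] with hF
  have hOF : ∀ j, j ≠ 0 → (O 0 j = 0 ∧ F 0 j = v j) ∨ (O 0 j = v j ∧ F 0 j = 0) := by
    intro j
    refine Fin.cases (fun h => absurd rfl h) (fun j _ => ?_) j
    refine Fin.cases (Or.inl ?_) (fun j => Or.inr ?_) j
    · simp [hO, hF, hx, hw, hv]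
    · simp [hO, hF, hx, hw, hv]
  have hOext := mem_extremePoints_of_atBound hOmem 0 fun j hj =>
    (hOF j hj).elim (fun h => Or.inl h.1) fun h => Or.inr h.1
  have hFext := mem_extremePoints_of_atBound hFmem 0 fun j hj =>
    (hOF j hj).elim (fun h => Or.inr h.2) fun h => Or.inl h.2
  have hO0 : ¬ AtBound v O 0 := by
    unfold AtBound
    rw [hv0, show O 0 0 = 1 from rfl]
    norm_num
  refine ⟨u, v, fun i => by simp only [hu]; positivity, hvpos, hsum, le_antisymm ediam_le ?_⟩
  have hle := SimpleGraph.edist_le_ediam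
    (G := vertexEdgeGraph (transportationPolytope u v)) (u := ⟨O, hOext⟩) (v := ⟨F, hFext⟩)
  refine le_trans ?_ hle
  rw [SimpleGraph.edist]
  refine le_iInf fun p => ?_
  exact_mod_cast le_length_of_opposite (by omega) hnd hvj hO0 hOF p

end Bounds

theorem theorem3 :
    -- the diameter bounds and the monotone bounds, for all margins
    (∀ (n : ℕ) (u : Fin 2 → ℝ) (v : Fin n → ℝ),
      (∀ i, 0 < u i) → (∀ j, 0 < v j) → ∑ i, u i = ∑ j, v j →
        (vertexEdgeGraph (transportationPolytope u v)).ediam ≤ n ∧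
        (vertexEdgeGraph (transportationPolytope u v)).ediam + (criticalEdges u v).ncard ≤ n + 1 ∧
        ∀ (s : Matrix (Fin 2) (Fin n) ℝ) (O : (transportationPolytope u v).extremePoints ℝ),
          ∃ (F : (transportationPolytope u v).extremePoints ℝ)
            (p : (vertexEdgeGraph (transportationPolytope u v)).Walk O F),
            IsMaxOn (objective s) (transportationPolytope u v) F.1 ∧
            IsMonotoneWalk s p ∧
            p.length ≤ n ∧
            p.length + (criticalEdges u v).ncard ≤ n + 1) ∧
    -- tightness of the diameter bound
    (∀ n : ℕ, 3 ≤ n → ∃ (u : Fin 2 → ℝ) (v : Fin n → ℝ),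
      (∀ i, 0 < u i) ∧ (∀ j, 0 < v j) ∧ ∑ i, u i = ∑ j, v j ∧
        (vertexEdgeGraph (transportationPolytope u v)).ediam = n) := by
  refine ⟨fun n u v hu hv hsum => ?_, fun n hn => ?_⟩
  · have : NeZero n := ⟨by
      rintro rfl
      rw [Fin.sum_univ_two, Fin.sum_univ_zero] at hsum
      linarith [hu 0, hu 1]⟩
    exact ⟨ediam_le, ediam_add_ncard_criticalEdges_le hu hv hsum,
      exists_monotone_walk hu hv hsum⟩
  · obtain ⟨m, rfl⟩ := Nat.exists_eq_add_of_le' hn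
    exact exists_ediam_eq m
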